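/- Let $\Sigma$ be a (finite-dimensional, Hausdorff, second countable) smooth manifold with possibly empty boundary, and let $\{\nu_t\}_{t\in S^1}$ be a smooth family of closed one-forms on $\Sigma$; that is, each $\nu_t$ is a smooth one-form on $\Sigma$ with $d\nu_t=0$, and the map $S^1\times\Sigma\to T^*\Sigma$, $(t,x)\mapsto \nu_t|_x$, is smooth. For $t\in S^1$ let $i_t:\Sigma\to S^1\times\Sigma$, $i_t(x)=(t,x)$. Then the following are equivalent: 1. there exists a smooth closed one-form $\nu$ on $S^1\times\Sigma$ such that $i_t^*\nu=\nu_t$ for every $t\in S^1$; 2. the de Rham cohomology class $[\nu_t]\in H^1_{\mathrm{dR}}(\Sigma)$ does not depend on $t$, i.e. $[\nu_s]=[\nu_t]$ for all $s,t\in S^1$. -/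

import Mathlib

open scoped Manifold ContDiff Topology Bundle

noncomputable section

namespace DeRham

section Basic

variable {E : Type*} [NormedAddCommGroup E] [NormedSpace ℝ E]
  {H : Type*} [TopologicalSpace H] (I : ModelWithCorners ℝ E H)
  (M : Type*) [TopologicalSpace M] [ChartedSpace H M] [IsManifold I ∞ M]

/-- The real vector space `Ω¹(M)` of smooth one-forms on `M`: the smooth sections of the
cotangent bundle, whose fibre at `x` is `TangentSpace I x →L[ℝ] ℝ`. -/
abbrev OneForm : Type _ :=
  ContMDiffSection I (E →L[ℝ] ℝ) ∞ (fun x : M => TangentSpace I x →L[ℝ] ℝ)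

variable {M} {I}

/-- The expression of a one-form in the chart at `x₀`, that is, its pullback under the
inverse of the extended chart, as a one-form on the model vector space (meaningful on the target
of the extended chart, a subset of `Set.range I`). -/
def OneForm.inChart (α : OneForm I M) (x₀ : M) (y : E) : E →L[ℝ] ℝ :=
  (α ((extChartAt I x₀).symm y)).comp
    (mfderivWithin 𝓘(ℝ, E) I (extChartAt I x₀).symm (Set.range I) y)

/-- The exterior derivative `dα` of a one-form at the point `x`, an alternating bilinear form on
the tangent space at `x`. It is the exterior derivative, within the range of the model, of the
expression of `α` in the chart at `x`; recall that `TangentSpace I x` is the model vector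
space `E`, identified with the geometric tangent space by the derivative of that same chart. -/
def OneForm.extDeriv (α : OneForm I M) (x : M) : TangentSpace I x [⋀^Fin 2]→L[ℝ] ℝ :=
  (extDerivWithin (fun y => ContinuousAlternatingMap.ofSubsingleton ℝ E ℝ (0 : Fin 1)
    (α.inChart x y)) (Set.range I) (extChartAt I x x) : E [⋀^Fin 2]→L[ℝ] ℝ)

theorem OneForm.inChart_add (α β : OneForm I M) (x₀ : M) :
    (α + β).inChart x₀ = α.inChart x₀ + β.inChart x₀ := by
  ext y v; rfl

theorem OneForm.inChart_smul (c : ℝ) (α : OneForm I M) (x₀ : M) :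
    (c • α).inChart x₀ = c • α.inChart x₀ := by
  ext y v; rfl

theorem OneForm.differentiableWithinAt_inChart (α : OneForm I M) (x : M) :
    DifferentiableWithinAt ℝ (α.inChart x) (Set.range I) (extChartAt I x x) := by
  have h := (contMDiffAt_hom_bundle _).1 (α.contMDiff x)
  have h2 := (h.2.mdifferentiableAt (by simp))
  have h3 := mdifferentiableWithinAt_extChartAt_symm (I := I) (mem_extChartAt_target (I := I) x)
  have hx : (extChartAt I x).symm (extChartAt I x x) = x := extChartAt_to_inv x
  rw [← hx] at h2
  have h4 := MDifferentiableAt.comp_mdifferentiableWithinAt _ h2 h3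
  rw [mdifferentiableWithinAt_iff_differentiableWithinAt] at h4
  have key : ∀ y ∈ (extChartAt I x).target, α.inChart x y =
      ContinuousLinearMap.inCoordinates E (TangentSpace I) ℝ (fun _ : M => ℝ) x
        ((extChartAt I x).symm y) x ((extChartAt I x).symm y) (α ((extChartAt I x).symm y)) := by
    intro y hy
    have hs : (extChartAt I x).symm y ∈ (chartAt H x).source := by
      rw [← extChartAt_source I]; exact (extChartAt I x).map_target hy
    have := TangentBundle.symmL_trivializationAt (I := I) hs
    rw [(extChartAt I x).right_inv hy] at this
    unfold OneForm.inChart ContinuousLinearMap.inCoordinates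
    rw [this]
    ext v
    simp
    rfl
  refine h4.congr_of_eventuallyEq ?_ ?_
  · filter_upwards [extChartAt_target_mem_nhdsWithin (I := I) x] with y hy
    rw [key y hy, Function.comp_apply, hx]
  · rw [key _ (mem_extChartAt_target (I := I) x), Function.comp_apply, hx]

theorem OneForm.extDeriv_add (α β : OneForm I M) (x : M) :
    (α + β).extDeriv x = α.extDeriv x + β.extDeriv x := by
  have hα := (ContinuousAlternatingMap.ofSubsingletonLIE (𝕜 := ℝ) (E := E) (F := ℝ)
    (0 : Fin 1)).differentiable.differentiableAt.comp_differentiableWithinAt _ (α.differentiableWithinAt_inChart x)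
  have hβ := (ContinuousAlternatingMap.ofSubsingletonLIE (𝕜 := ℝ) (E := E) (F := ℝ)
    (0 : Fin 1)).differentiable.differentiableAt.comp_differentiableWithinAt _ (β.differentiableWithinAt_inChart x)
  have h := extDerivWithin_add
    (I.uniqueDiffOn.uniqueDiffWithinAt (Set.mem_range_self _)) hα hβ
  unfold OneForm.extDeriv
  rw [OneForm.inChart_add]
  exact h

theorem OneForm.extDeriv_smul (c : ℝ) (α : OneForm I M) (x : M) :
    (c • α).extDeriv x = c • α.extDeriv x := by
  unfold OneForm.extDeriv
  rw [OneForm.inChart_smul]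
  exact extDerivWithin_smul c
    (fun y => ContinuousAlternatingMap.ofSubsingleton ℝ E ℝ (0 : Fin 1) (α.inChart x y))
    (I.uniqueDiffOn.uniqueDiffWithinAt (Set.mem_range_self _))

variable (I M)

/-- The space `Z¹(M)` of closed one-forms. -/
def closedForms : Submodule ℝ (OneForm I M) where
  carrier := {α | ∀ x, α.extDeriv x = 0}
  add_mem' {α β} hα hβ x := by rw [OneForm.extDeriv_add, hα x, hβ x, add_zero]
  zero_mem' x := by
    have h := OneForm.extDeriv_smul (0 : ℝ) (0 : OneForm I M) x
    have h0 : (0 : ℝ) • (0 : OneForm I M) = 0 := by ext y v; simp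
    have h1 : (0 : ℝ) • (0 : OneForm I M).extDeriv x = 0 := zero_smul ℝ _
    rwa [h0, h1] at h
  smul_mem' c α hα x := by rw [OneForm.extDeriv_smul, hα x, smul_zero]

/-- The space `B¹(M)` of exact one-forms, the differentials of smooth real functions. -/
def exactForms : Submodule ℝ (OneForm I M) where
  carrier := {α | ∃ f : M → ℝ, ContMDiff I 𝓘(ℝ, ℝ) ∞ f ∧ ∀ x, α x = mvfderiv I f x}
  add_mem' := by
    rintro α β ⟨f, hf, hα⟩ ⟨g, hg, hβ⟩
    refine ⟨f + g, hf.add hg, fun x => ?_⟩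
    rw [mvfderiv_add (hf.mdifferentiableAt (by simp)) (hg.mdifferentiableAt (by simp)),
      ← hα, ← hβ]
    rfl
  zero_mem' := ⟨fun _ => 0, contMDiff_const, fun x => by rw [mvfderiv_const]; rfl⟩
  smul_mem' := by
    rintro c α ⟨f, hf, hα⟩
    refine ⟨fun x => c • f x, (contDiff_const_smul c).contMDiff.comp hf, fun x => ?_⟩
    have := mvfderiv_fun_smul (I := I) (a := fun _ : M => c) (x := x) mdifferentiableAt_const
      (hf.mdifferentiableAt (by simp))
    rw [this, mvfderiv_const]
    simp [← hα]

/-- The first de Rham cohomology space `H¹(M) = Z¹(M) / B¹(M)`. -/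
abbrev H1 : Type _ := closedForms I M ⧸ (exactForms I M).submoduleOf (closedForms I M)

variable {I M}

/-- The de Rham cohomology class `[α]` of a closed one-form. -/
def cohomologyClass (α : closedForms I M) : H1 I M :=
  Submodule.Quotient.mk α

end Basic

section Maps

variable {E : Type*} [NormedAddCommGroup E] [NormedSpace ℝ E]
  {H : Type*} [TopologicalSpace H] {I : ModelWithCorners ℝ E H}
  {M : Type*} [TopologicalSpace M] [ChartedSpace H M] [IsManifold I ∞ M]
  {E' : Type*} [NormedAddCommGroup E'] [NormedSpace ℝ E']
  {H' : Type*} [TopologicalSpace H'] {J : ModelWithCorners ℝ E' H'}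
  {N : Type*} [TopologicalSpace N] [ChartedSpace H' N] [IsManifold J ∞ N]

/-- The value `(f^* α)_x` at the point `x` of the pullback of a one-form under a map. -/
def OneForm.pullbackAt (α : OneForm J N) (f : M → N) (x : M) : TangentSpace I x →L[ℝ] ℝ :=
  (α (f x)).comp (mfderiv I J f x)

/-- A family `(α_t)`, indexed by the points `t` of a manifold `N`, of one-forms on `M` is smooth
if `(t, x) ↦ α_t|_x` is a smooth map from `N × M` to the total space of the cotangent bundle
of `M`. -/
def IsSmoothFamily (J : ModelWithCorners ℝ E' H') (α : N → OneForm I M) : Prop :=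
  ContMDiff (J.prod I) (I.prod 𝓘(ℝ, E →L[ℝ] ℝ)) ∞
    (fun p : N × M => (Bundle.TotalSpace.mk' (E →L[ℝ] ℝ) p.2 (α p.1 p.2) :
      Bundle.TotalSpace (E →L[ℝ] ℝ) (fun x : M => TangentSpace I x →L[ℝ] ℝ)))

end Maps

end DeRham

end

open DeRham

set_option linter.unusedSectionVars false

section

open Set MeasureTheory intervalIntegral

universe u

theorem continuousOn_integral_zero_one {P F : Type*} [NormedAddCommGroup P]
    [NormedAddCommGroup F] [NormedSpace ℝ F] {g : P × ℝ → F} {s : Set P}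
    (hg : ContinuousOn g (s ×ˢ Icc (0 : ℝ) 1)) :
    ContinuousOn (fun p => ∫ r in (0 : ℝ)..1, g (p, r)) s := by
  rw [continuousOn_iff_continuous_domRestrict]
  have h : Continuous (fun q : s × ℝ => g (q.1, projIcc (0 : ℝ) 1 zero_le_one q.2)) := by
    refine hg.comp_continuous (by fun_prop) ?_
    rintro ⟨p, r⟩
    exact ⟨p.2, Subtype.coe_prop _⟩
  have h2 := intervalIntegral.continuous_parametric_intervalIntegral_of_continuous'
    (f := fun (p : s) (r : ℝ) => g (p, projIcc (0 : ℝ) 1 zero_le_one r)) (μ := volume) h 0 1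
  refine h2.congr fun p => ?_
  refine intervalIntegral.integral_congr fun r hr => ?_
  rw [uIcc_of_le zero_le_one] at hr
  simp [projIcc_of_mem _ hr]

theorem intervalIntegrable_slice {P F : Type*} [NormedAddCommGroup P]
    [NormedAddCommGroup F] {g : P × ℝ → F} {s : Set P}
    (hg : ContinuousOn g (s ×ˢ Icc (0 : ℝ) 1)) {p : P} (hp : p ∈ s) :
    IntervalIntegrable (fun r => g (p, r)) volume 0 1 := by
  refine ContinuousOn.intervalIntegrable ?_
  rw [uIcc_of_le zero_le_one]
  exact hg.comp (by fun_prop) fun r hr => ⟨hp, hr⟩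

theorem hasFDerivWithinAt_integral_zero_one {P F : Type*} [NormedAddCommGroup P]
    [NormedSpace ℝ P] [NormedAddCommGroup F] [NormedSpace ℝ F] [CompleteSpace F]
    {g : P × ℝ → F} {D : P × ℝ → P →L[ℝ] F} {s : Set P} (hs : Convex ℝ s)
    (hg : ContinuousOn g (s ×ˢ Icc (0 : ℝ) 1)) (hD : ContinuousOn D (s ×ˢ Icc (0 : ℝ) 1))
    (hgD : ∀ p ∈ s, ∀ r ∈ Icc (0 : ℝ) 1,
      HasFDerivWithinAt (fun p => g (p, r)) (D (p, r)) s p) {p : P} (hp : p ∈ s) :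
    HasFDerivWithinAt (fun p => ∫ r in (0 : ℝ)..1, g (p, r)) (∫ r in (0 : ℝ)..1, D (p, r)) s p := by
  rw [hasFDerivWithinAt_iff_isLittleO, Asymptotics.isLittleO_iff]
  intro ε hε
  obtain ⟨v, hv, hvε⟩ := isCompact_Icc.mem_uniformity_of_prod
    (f := fun p r => D (p, r)) (s := s) (k := Icc (0 : ℝ) 1) (by exact hD) hp
    (Metric.dist_mem_uniformity hε)
  obtain ⟨δ, hδ, hball⟩ := Metric.mem_nhdsWithin_iff.1 hv
  filter_upwards [Filter.inter_mem (mem_nhdsWithin_of_mem_nhds (Metric.ball_mem_nhds p hδ))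
    self_mem_nhdsWithin] with q hq
  have hi := intervalIntegrable_slice hD hp
  have hi2 : IntervalIntegrable (fun r => D (p, r) (q - p)) volume 0 1 :=
    intervalIntegrable_slice (g := fun x => D x (q - p)) (hD.clm_apply continuousOn_const) hp
  have hgq := intervalIntegrable_slice hg hq.2
  have hgp := intervalIntegrable_slice hg hp
  rw [ContinuousLinearMap.intervalIntegral_apply hi,
    ← intervalIntegral.integral_sub hgq hgp, ← intervalIntegral.integral_sub (hgq.sub hgp) hi2]
  have key : ∀ r ∈ uIoc (0 : ℝ) 1,
      ‖g (q, r) - g (p, r) - D (p, r) (q - p)‖ ≤ ε * ‖q - p‖ := by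
    intro r hr
    rw [uIoc_of_le zero_le_one] at hr
    have hr' : r ∈ Icc (0 : ℝ) 1 := ⟨hr.1.le, hr.2⟩
    refine ((convex_ball p δ).inter hs).norm_image_sub_le_of_norm_hasFDerivWithin_le'
      (f := fun p => g (p, r)) (f' := fun p => D (p, r))
      (fun x hx => (hgD x hx.2 r hr').mono inter_subset_right) (fun x hx => ?_)
      ⟨Metric.mem_ball_self hδ, hp⟩ hq
    have := hvε x (hball hx) r hr'
    rw [← dist_eq_norm]
    exact this.le
  simpa using intervalIntegral.norm_integral_le_of_norm_le_const key

theorem contDiffOn_integral_zero_one_nat {P : Type u} [NormedAddCommGroup P] [NormedSpace ℝ P]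
    {s : Set P} (hs : Convex ℝ s) (hu : UniqueDiffOn ℝ s) (n : ℕ) :
    ∀ {F : Type u} [NormedAddCommGroup F] [NormedSpace ℝ F] [CompleteSpace F] {g : P × ℝ → F},
      ContDiffOn ℝ n g (s ×ˢ Icc (0 : ℝ) 1) →
      ContDiffOn ℝ n (fun p => ∫ r in (0 : ℝ)..1, g (p, r)) s := by
  induction n with
  | zero =>
    intro F _ _ _ g hg
    have := continuousOn_integral_zero_one hg.continuousOn
    exact_mod_cast contDiffOn_zero.2 this
  | succ n ih =>
    intro F _ _ _ g hg
    have hu2 : UniqueDiffOn ℝ (s ×ˢ Icc (0 : ℝ) 1) := hu.prod uniqueDiffOn_Icc_zero_one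
    have hD : ContDiffOn ℝ n (fun x : P × ℝ =>
        (fderivWithin ℝ g (s ×ˢ Icc (0 : ℝ) 1) x).comp (ContinuousLinearMap.inl ℝ P ℝ))
        (s ×ˢ Icc (0 : ℝ) 1) :=
      (hg.fderivWithin hu2 (m := n) (by norm_cast)).clm_comp contDiffOn_const
    have hder : ∀ p ∈ s, HasFDerivWithinAt (fun p => ∫ r in (0 : ℝ)..1, g (p, r))
        (∫ r in (0 : ℝ)..1, (fderivWithin ℝ g (s ×ˢ Icc (0 : ℝ) 1) (p, r)).comp
          (ContinuousLinearMap.inl ℝ P ℝ)) s p := by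
      intro p hp
      refine hasFDerivWithinAt_integral_zero_one (D := fun x : P × ℝ =>
        (fderivWithin ℝ g (s ×ˢ Icc (0 : ℝ) 1) x).comp (ContinuousLinearMap.inl ℝ P ℝ)) hs
        hg.continuousOn hD.continuousOn (fun q hq r hr => ?_) hp
      have h1 := (hg.differentiableOn (by simp) (q, r) ⟨hq, hr⟩).hasFDerivWithinAt
      exact h1.comp q (hasFDerivAt_prodMk_left q r).hasFDerivWithinAt
        fun x hx => (⟨hx, hr⟩ : (x, r) ∈ s ×ˢ Icc (0 : ℝ) 1)
    push_cast
    rw [contDiffOn_succ_iff_hasFDerivWithinAt_of_uniqueDiffOn hu]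
    exact ⟨by simp, _, ih hD, hder⟩

/-- Integrals over `[0, 1]` depend smoothly on parameters in a convex set. -/
theorem contDiffOn_integral_zero_one {P F : Type u} [NormedAddCommGroup P] [NormedSpace ℝ P]
    [NormedAddCommGroup F] [NormedSpace ℝ F] [CompleteSpace F]
    {s : Set P} (hs : Convex ℝ s) (hu : UniqueDiffOn ℝ s) {g : P × ℝ → F}
    (hg : ContDiffOn ℝ ∞ g (s ×ˢ Icc (0 : ℝ) 1)) :
    ContDiffOn ℝ ∞ (fun p => ∫ r in (0 : ℝ)..1, g (p, r)) s :=
  contDiffOn_infty.2 fun n =>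
    contDiffOn_integral_zero_one_nat hs hu n (hg.of_le (by exact_mod_cast le_top))

/-- The primitives, vanishing at `y₀`, of a smooth family of exact one-forms on a convex set form a
smooth family. -/
theorem contDiffOn_primitive_sub {P E : Type*} [NormedAddCommGroup P] [NormedSpace ℝ P]
    [NormedAddCommGroup E] [NormedSpace ℝ E] {A : Set P} {B : Set E} (hA : Convex ℝ A)
    (hB : Convex ℝ B) (hAu : UniqueDiffOn ℝ A) (hBu : UniqueDiffOn ℝ B) {h : P × E → ℝ}
    {η : P × E → E →L[ℝ] ℝ} (hη : ContDiffOn ℝ ∞ η (A ×ˢ B))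
    (hh : ∀ p ∈ A, ∀ y ∈ B, HasFDerivWithinAt (fun y => h (p, y)) (η (p, y)) B y)
    {y₀ : E} (hy₀ : y₀ ∈ B) :
    ContDiffOn ℝ ∞ (fun q : P × E => h q - h (q.1, y₀)) (A ×ˢ B) := by
  set m : (P × E) × ℝ → P × E := fun z => (z.1.1, y₀ + z.2 • (z.1.2 - y₀)) with hm
  have hmB : ∀ y ∈ B, ∀ r ∈ Icc (0 : ℝ) 1, y₀ + r • (y - y₀) ∈ B :=
    fun y hy r hr => hB.add_smul_sub_mem hy₀ hy hr
  have hmc : ContDiff ℝ ∞ m := by fun_prop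
  have hg : ContDiffOn ℝ ∞ (fun z => (η (m z)).comp (ContinuousLinearMap.snd ℝ P E))
      ((A ×ˢ B) ×ˢ Icc (0 : ℝ) 1) :=
    (hη.comp hmc.contDiffOn fun z hz => ⟨hz.1.1, hmB _ hz.1.2 _ hz.2⟩).clm_comp contDiffOn_const
  have hint := contDiffOn_integral_zero_one (hA.prod hB) (hAu.prod hBu) hg
  refine (hint.clm_apply (g := fun q : P × E => ((0 : P), q.2 - y₀)) (by fun_prop)).congr ?_
  rintro ⟨p, y⟩ ⟨hp, hy⟩
  simp only at hp hy ⊢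
  have hq : (p, y) ∈ A ×ˢ B := ⟨hp, hy⟩
  rw [ContinuousLinearMap.intervalIntegral_apply (intervalIntegrable_slice hg.continuousOn hq)]
  have hc : ContinuousOn (fun r : ℝ => η (p, y₀ + r • (y - y₀)) (y - y₀)) (Icc 0 1) :=
    (hη.continuousOn.comp (by fun_prop) fun r hr => ⟨hp, hmB y hy r hr⟩).clm_apply
      continuousOn_const
  have hd : ∀ r ∈ Icc (0 : ℝ) 1, HasDerivWithinAt (fun r : ℝ => h (p, y₀ + r • (y - y₀)))
      (η (p, y₀ + r • (y - y₀)) (y - y₀)) (Icc 0 1) r := by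
    intro r hr
    have h1 : HasDerivWithinAt (fun r : ℝ => y₀ + r • (y - y₀)) (y - y₀) (Icc 0 1) r := by
      simpa using (((hasDerivAt_id r).smul_const (y - y₀)).const_add y₀).hasDerivWithinAt
    exact (hh p hp _ (hmB y hy r hr)).comp_hasDerivWithinAt r h1 fun r hr => hmB y hy r hr
  have := intervalIntegral.integral_eq_sub_of_hasDeriv_right_of_le zero_le_one
    (fun r hr => (hd r hr).continuousWithinAt)
    (fun r hr => ((hd r (Ioo_subset_Icc_self hr)).hasDerivAt (Icc_mem_nhds hr.1 hr.2)).hasDerivWithinAt)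
    (hc.intervalIntegrable_of_Icc zero_le_one)
  simp only [hm, ContinuousLinearMap.comp_apply, ContinuousLinearMap.coe_snd']
  rw [this]
  simp

theorem extDerivWithin_ofSubsingleton_eq_zero_iff {Q : Type*} [NormedAddCommGroup Q]
    [NormedSpace ℝ Q] {f : Q → Q →L[ℝ] ℝ} {s : Set Q} {x : Q}
    (hf : DifferentiableWithinAt ℝ f s x) (hs : UniqueDiffWithinAt ℝ s x) :
    extDerivWithin (fun y => ContinuousAlternatingMap.ofSubsingleton ℝ Q ℝ (0 : Fin 1) (f y)) s x
      = 0 ↔ ∀ v w, fderivWithin ℝ f s x v w = fderivWithin ℝ f s x w v := by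
  have hd : DifferentiableWithinAt ℝ
      (fun y => ContinuousAlternatingMap.ofSubsingleton ℝ Q ℝ (0 : Fin 1) (f y)) s x :=
    (ContinuousAlternatingMap.ofSubsingletonLIE (𝕜 := ℝ) (E := Q) (F := ℝ)
      (0 : Fin 1)).differentiable.differentiableAt.comp_differentiableWithinAt _ hf
  have key : ∀ v : Fin 2 → Q, extDerivWithin
      (fun y => ContinuousAlternatingMap.ofSubsingleton ℝ Q ℝ (0 : Fin 1) (f y)) s x v =
      fderivWithin ℝ f s x (v 0) (v 1) - fderivWithin ℝ f s x (v 1) (v 0) := by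
    intro v
    rw [extDerivWithin_apply hd hs, Fin.sum_univ_two]
    have h (w : Q) : fderivWithin ℝ (fun y => f y w) s x = (fderivWithin ℝ f s x).flip w := by
      rw [fderivWithin_clm_apply hs hf (differentiableWithinAt_const w)]
      simp
    simp [Fin.removeNth, Fin.succAbove, Fin.tail, h, sub_eq_add_neg]
  constructor
  · intro h v w
    have := key ![v, w]
    rw [h] at this
    exact sub_eq_zero.1 (by simpa using this.symm)
  · intro h
    ext v
    rw [key, h, sub_self]
    rfl

section

variable {E : Type*} [NormedAddCommGroup E] [NormedSpace ℝ E]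
  {H : Type*} [TopologicalSpace H] {I : ModelWithCorners ℝ E H}
  {M : Type*} [TopologicalSpace M] [ChartedSpace H M] [IsManifold I ∞ M]
  {E' : Type*} [NormedAddCommGroup E'] [NormedSpace ℝ E']
  {H' : Type*} [TopologicalSpace H'] {J : ModelWithCorners ℝ E' H'}
  {N : Type*} [TopologicalSpace N] [ChartedSpace H' N] [IsManifold J ∞ N]
  {Q : Type*} [NormedAddCommGroup Q] [NormedSpace ℝ Q]

theorem mem_closed_iff (α : OneForm I M) : α ∈ closedForms I M ↔ ∀ x v w,
    fderivWithin ℝ (α.inChart x) (range I) (extChartAt I x x) v w =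
      fderivWithin ℝ (α.inChart x) (range I) (extChartAt I x x) w v :=
  forall_congr' fun x => extDerivWithin_ofSubsingleton_eq_zero_iff
    (α.differentiableWithinAt_inChart x) (I.uniqueDiffOn.uniqueDiffWithinAt (mem_range_self _))

theorem inCoordinates_cotangent {x₀ x : M} (hx : x ∈ (chartAt H x₀).source)
    (L : TangentSpace I x →L[ℝ] ℝ) :
    ContinuousLinearMap.inCoordinates E (TangentSpace I) ℝ (fun _ : M => ℝ) x₀ x x₀ x L =
      L.comp (mfderivWithin 𝓘(ℝ, E) I (extChartAt I x₀).symm (range I) (extChartAt I x₀ x)) := by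
  unfold ContinuousLinearMap.inCoordinates
  rw [TangentBundle.symmL_trivializationAt (I := I) hx]
  ext v
  simp
  rfl

theorem contDiffOn_cotangent_coordinates {b : Q → M} {L : ∀ q, TangentSpace I (b q) →L[ℝ] ℝ}
    {s : Set Q}
    (h : ContMDiffOn 𝓘(ℝ, Q) (I.prod 𝓘(ℝ, E →L[ℝ] ℝ)) ∞
      (fun q => (Bundle.TotalSpace.mk' (E →L[ℝ] ℝ) (b q) (L q) :
        Bundle.TotalSpace (E →L[ℝ] ℝ) (fun x : M => TangentSpace I x →L[ℝ] ℝ))) s)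
    {x₀ : M} (hb : MapsTo b s (chartAt H x₀).source) :
    ContDiffOn ℝ ∞ (fun q => ((L q).comp (mfderivWithin 𝓘(ℝ, E) I (extChartAt I x₀).symm
      (range I) (extChartAt I x₀ (b q))) : E →L[ℝ] ℝ)) s := by
  have h2 := ((trivializationAt (E →L[ℝ] ℝ)
    (fun x : M => TangentSpace I x →L[ℝ] ℝ) x₀).contMDiffOn_iff (IB := I) ?_).1 h
  · refine h2.2.contDiffOn.congr fun q hq => ?_
    exact (inCoordinates_cotangent (hb hq) (L q)).symm
  · intro q hq
    rw [hom_trivializationAt_source]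
    exact ⟨hb hq, mem_univ _⟩

theorem contDiffOn_inChart (α : OneForm I M) (x₀ : M) :
    ContDiffOn ℝ ∞ (α.inChart x₀) (extChartAt I x₀).target := by
  have h := α.contMDiff.comp_contMDiffOn (contMDiffOn_extChartAt_symm (I := I) (n := ∞) x₀)
  refine (contDiffOn_cotangent_coordinates h (x₀ := x₀) ?_).congr ?_
  · intro y hy
    rw [← extChartAt_source I]
    exact (extChartAt I x₀).map_target hy
  · intro y hy
    unfold OneForm.inChart
    rw [(extChartAt I x₀).right_inv hy]

theorem IsSmoothFamily.contDiffOn_inChart {α : N → OneForm I M} (hα : IsSmoothFamily J α)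
    (t₀ : N) (x₀ : M) :
    ContDiffOn ℝ ∞ (fun q : E' × E => (α ((extChartAt J t₀).symm q.1)).inChart x₀ q.2)
      ((extChartAt J t₀).target ×ˢ (extChartAt I x₀).target) := by
  have h1 : ContMDiffOn 𝓘(ℝ, E' × E) (J.prod I) ∞
      (fun q : E' × E => ((extChartAt J t₀).symm q.1, (extChartAt I x₀).symm q.2))
      ((extChartAt J t₀).target ×ˢ (extChartAt I x₀).target) := by
    refine ContMDiffOn.prodMk ?_ ?_
    · exact (contMDiffOn_extChartAt_symm t₀).comp contDiff_fst.contMDiff.contMDiffOn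
        fun q hq => hq.1
    · exact (contMDiffOn_extChartAt_symm x₀).comp contDiff_snd.contMDiff.contMDiffOn
        fun q hq => hq.2
  have h := ContMDiff.comp_contMDiffOn hα h1
  refine (contDiffOn_cotangent_coordinates h (x₀ := x₀) ?_).congr ?_
  · intro y hy
    rw [← extChartAt_source I]
    exact (extChartAt I x₀).map_target hy.2
  · intro y hy
    unfold OneForm.inChart
    simp only
    rw [(extChartAt I x₀).right_inv hy.2]

theorem contMDiffAt_cotangent_section {α : ∀ x : M, TangentSpace I x →L[ℝ] ℝ} {x₀ : M}
    (h : ContDiffWithinAt ℝ ∞ (fun y => ((α ((extChartAt I x₀).symm y)).comp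
      (mfderivWithin 𝓘(ℝ, E) I (extChartAt I x₀).symm (range I) y) : E →L[ℝ] ℝ))
      (range I) (extChartAt I x₀ x₀)) :
    ContMDiffAt I (I.prod 𝓘(ℝ, E →L[ℝ] ℝ)) ∞
      (fun x => (Bundle.TotalSpace.mk' (E →L[ℝ] ℝ) x (α x) :
        Bundle.TotalSpace (E →L[ℝ] ℝ) (fun x : M => TangentSpace I x →L[ℝ] ℝ))) x₀ := by
  rw [contMDiffAt_hom_bundle]
  refine ⟨contMDiffAt_id, ?_⟩
  have h2 := h.contMDiffWithinAt.comp (t := range I) (s := univ) x₀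
    (contMDiffAt_extChartAt (I := I) (n := ∞) (x := x₀)).contMDiffWithinAt
    (fun x _ => by simp [extChartAt])
  refine (contMDiffWithinAt_univ.1 h2).congr_of_eventuallyEq ?_
  filter_upwards [(chartAt H x₀).open_source.mem_nhds (mem_chart_source H x₀)] with x hx
  simp only [Function.comp_apply]
  rw [inCoordinates_cotangent hx, (extChartAt I x₀).left_inv (by rwa [extChartAt_source])]
  rfl

/-- The pullback of a one-form to a set in a normed space. -/
noncomputable def DeRham.OneForm.pullbackWithin (α : OneForm I M) (h : Q → M) (s : Set Q) (q : Q) :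
    Q →L[ℝ] ℝ :=
  (α (h q)).comp (mfderivWithin 𝓘(ℝ, Q) I h s q)

theorem pullbackWithin_eventuallyEq (α : OneForm I M) {h : Q → M} {s : Set Q}
    (hs : UniqueDiffOn ℝ s) (hh : ContMDiffOn 𝓘(ℝ, Q) I ∞ h s) {x₀ : M} {q₀ : Q} (hq₀ : q₀ ∈ s)
    (hx₀ : h q₀ ∈ (chartAt H x₀).source) :
    ∀ᶠ q in 𝓝[s] q₀, α.pullbackWithin h s q =
      (α.inChart x₀ (extChartAt I x₀ (h q))).comp
        (fderivWithin ℝ (fun q => extChartAt I x₀ (h q)) s q) := by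
  filter_upwards [self_mem_nhdsWithin, (hh q₀ hq₀).continuousWithinAt.preimage_mem_nhdsWithin
    ((chartAt H x₀).open_source.mem_nhds hx₀)] with q hq hqs
  have hqs' : h q ∈ (chartAt H x₀).source := hqs
  have hqe : h q ∈ (extChartAt I x₀).source := by rwa [extChartAt_source]
  have hd := (hh q hq).mdifferentiableWithinAt (by simp)
  have h1 : mfderivWithin 𝓘(ℝ, Q) I h s q =
      (mfderivWithin 𝓘(ℝ, E) I (extChartAt I x₀).symm (range I) (extChartAt I x₀ (h q))).comp
        (mfderivWithin 𝓘(ℝ, Q) 𝓘(ℝ, E) (fun q => extChartAt I x₀ (h q)) s q) := by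
    rw [← mfderivWithin_comp q (u := range I) (f := fun q => extChartAt I x₀ (h q))
      (mdifferentiableWithinAt_extChartAt_symm ((extChartAt I x₀).map_source hqe))
      ((mdifferentiableAt_extChartAt hqs').comp_mdifferentiableWithinAt q hd)
      (fun x _ => by simp [extChartAt]) (hs q hq).uniqueMDiffWithinAt]
    refine Filter.EventuallyEq.mfderivWithin_eq ?_ ?_
    · filter_upwards [(hh q hq).continuousWithinAt.preimage_mem_nhdsWithin
        ((chartAt H x₀).open_source.mem_nhds hqs')] with q' hq'
      have : h q' ∈ (extChartAt I x₀).source := by rwa [extChartAt_source]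
      exact ((extChartAt I x₀).left_inv this).symm
    · exact ((extChartAt I x₀).left_inv hqe).symm
  unfold OneForm.pullbackWithin OneForm.inChart
  rw [h1, mfderivWithin_eq_fderivWithin, (extChartAt I x₀).left_inv hqe]
  rfl

theorem contDiffWithinAt_extChartAt_comp {h : Q → M} {s : Set Q}
    (hh : ContMDiffOn 𝓘(ℝ, Q) I ∞ h s) {x₀ : M} {q₀ : Q} (hq₀ : q₀ ∈ s)
    (hx₀ : h q₀ ∈ (chartAt H x₀).source) :
    ContDiffWithinAt ℝ ∞ (fun q => extChartAt I x₀ (h q)) s q₀ :=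
  ((contMDiffAt_extChartAt' hx₀).comp_contMDiffWithinAt q₀ (hh q₀ hq₀)).contDiffWithinAt

theorem contDiffOn_pullbackWithin (α : OneForm I M) {h : Q → M} {s : Set Q}
    (hs : UniqueDiffOn ℝ s) (hh : ContMDiffOn 𝓘(ℝ, Q) I ∞ h s) :
    ContDiffOn ℝ ∞ (α.pullbackWithin h s) s := by
  intro q₀ hq₀
  have hx₀ := mem_chart_source H (h q₀)
  have hk := contDiffWithinAt_extChartAt_comp hh hq₀ hx₀
  have h1 : ContDiffWithinAt ℝ ∞ (fun q => α.inChart (h q₀) (extChartAt I (h q₀) (h q))) s q₀ := by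
    have := (contDiffOn_inChart α (h q₀) _ (mem_extChartAt_target (h q₀))).mono_of_mem_nhdsWithin
      (extChartAt_target_mem_nhdsWithin (h q₀))
    exact this.comp q₀ hk fun x _ => by simp [extChartAt]
  refine (h1.clm_comp (hk.fderivWithin_right hs (by simp) hq₀)).congr_of_eventuallyEq_of_mem
    (pullbackWithin_eventuallyEq α hs hh hq₀ hx₀) hq₀

theorem fderivWithin_pullbackWithin_symm {α : OneForm I M} (hα : α ∈ closedForms I M) {h : Q → M}
    {s : Set Q} (hs : UniqueDiffOn ℝ s) (hsi : s ⊆ closure (interior s))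
    (hh : ContMDiffOn 𝓘(ℝ, Q) I ∞ h s) {q : Q} (hq : q ∈ s) (v w : Q) :
    fderivWithin ℝ (α.pullbackWithin h s) s q v w =
      fderivWithin ℝ (α.pullbackWithin h s) s q w v := by
  have hx₀ := mem_chart_source H (h q)
  have hk := contDiffWithinAt_extChartAt_comp hh hq hx₀
  refine (extDerivWithin_ofSubsingleton_eq_zero_iff
    ((contDiffOn_pullbackWithin α hs hh q hq).differentiableWithinAt (by simp)) (hs q hq)).1 ?_ v w
  have hd : DifferentiableWithinAt ℝ (fun y => ContinuousAlternatingMap.ofSubsingleton ℝ E ℝ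
      (0 : Fin 1) (α.inChart (h q) y)) (range I) (extChartAt I (h q) (h q)) :=
    (ContinuousAlternatingMap.ofSubsingletonLIE (𝕜 := ℝ) (E := E) (F := ℝ)
      (0 : Fin 1)).differentiable.differentiableAt.comp_differentiableWithinAt _
      (α.differentiableWithinAt_inChart (h q))
  have hp := extDerivWithin_pullback (f := fun q' => extChartAt I (h q) (h q')) (r := ∞) hd hk
    (by simpa using WithTop.coe_le_coe.2 (le_top : (2 : ℕ∞) ≤ ⊤)) hs (hsi hq) hq
    (fun x _ => by simp [extChartAt])
  have h0 : extDerivWithin (fun y => ContinuousAlternatingMap.ofSubsingleton ℝ E ℝ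
      (0 : Fin 1) (α.inChart (h q) y)) (range I) (extChartAt I (h q) (h q)) = 0 := hα (h q)
  rw [h0] at hp
  refine Eq.trans (Filter.EventuallyEq.extDerivWithin_eq_of_mem ?_ hq) (hp.trans ?_)
  · filter_upwards [pullbackWithin_eventuallyEq α hs hh hq hx₀] with q' hq'
    rw [hq']
    ext v
    simp
  · ext v
    simp

theorem inChart_self (α : OneForm I M) (x : M) :
    α.inChart x (extChartAt I x x) = α x := by
  unfold OneForm.inChart
  rw [mfderivWithin_range_extChartAt_symm, extChartAt_to_inv]
  rfl

end

section

variable {E : Type*} [NormedAddCommGroup E] [NormedSpace ℝ E]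
  {H : Type*} [TopologicalSpace H] {I : ModelWithCorners ℝ E H}
  {M : Type*} [TopologicalSpace M] [ChartedSpace H M] [IsManifold I ∞ M]
  {E' : Type*} [NormedAddCommGroup E'] [NormedSpace ℝ E']
  {H' : Type*} [TopologicalSpace H'] {J : ModelWithCorners ℝ E' H'}
  {N : Type*} [TopologicalSpace N] [ChartedSpace H' N] [IsManifold J ∞ N]

theorem fderivWithin_range_eq_target {F : Type*} [NormedAddCommGroup F] [NormedSpace ℝ F]
    (f : E → F) {x₀ : M} {y : E} (hy : y ∈ (extChartAt I x₀).target) :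
    fderivWithin ℝ f (range I) y = fderivWithin ℝ f (extChartAt I x₀).target y := by
  refine fderivWithin_congr_set (nhdsWithin_eq_iff_eventuallyEq.1 ?_)
  exact (nhdsWithin_extChartAt_target_eq_of_mem hy).symm

theorem pullbackAt_comp_mfderivWithin_extChartAt_symm (α : OneForm J N) {u : M → N}
    (hu : ContMDiff I J ∞ u) (x₀ : M) {y : E} (hy : y ∈ (extChartAt I x₀).target) :
    ((α.pullbackAt (I := I) u ((extChartAt I x₀).symm y)).comp
      (mfderivWithin 𝓘(ℝ, E) I (extChartAt I x₀).symm (range I) y) : E →L[ℝ] ℝ) =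
      α.pullbackWithin (u ∘ (extChartAt I x₀).symm) (extChartAt I x₀).target y := by
  have hd := mdifferentiableWithinAt_extChartAt_symm (I := I) hy
  have hut : UniqueMDiffWithinAt 𝓘(ℝ, E) (extChartAt I x₀).target y :=
    (uniqueDiffOn_extChartAt_target x₀ y hy).uniqueMDiffWithinAt
  have h1 := hd.mono (extChartAt_target_subset_range (I := I) x₀)
  have h2 : mfderivWithin 𝓘(ℝ, E) I (extChartAt I x₀).symm (range I) y =
      mfderivWithin 𝓘(ℝ, E) I (extChartAt I x₀).symm (extChartAt I x₀).target y :=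
    (hd.mfderivWithin_mono hut (extChartAt_target_subset_range x₀)).symm
  unfold OneForm.pullbackWithin OneForm.pullbackAt
  rw [mfderiv_comp_mfderivWithin y (hu.mdifferentiableAt (by simp)) h1 hut, h2]
  rfl

theorem contMDiffOn_comp_extChartAt_symm {u : M → N} (hu : ContMDiff I J ∞ u) (x₀ : M) :
    ContMDiffOn 𝓘(ℝ, E) J ∞ (u ∘ (extChartAt I x₀).symm) (extChartAt I x₀).target :=
  hu.comp_contMDiffOn (contMDiffOn_extChartAt_symm x₀)

/-- The pullback of a one-form under a smooth map. -/
noncomputable def DeRham.OneForm.pullback (α : OneForm J N) (u : M → N) (hu : ContMDiff I J ∞ u) :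
    OneForm I M where
  toFun x := α.pullbackAt u x
  contMDiff_toFun x₀ := by
    refine contMDiffAt_cotangent_section ?_
    have h1 := (contDiffOn_pullbackWithin α (uniqueDiffOn_extChartAt_target x₀)
      (contMDiffOn_comp_extChartAt_symm hu x₀)).congr
      fun y hy => pullbackAt_comp_mfderivWithin_extChartAt_symm α hu x₀ hy
    exact (h1 _ (mem_extChartAt_target x₀)).mono_of_mem_nhdsWithin
      (extChartAt_target_mem_nhdsWithin x₀)

theorem pullback_mem_closedForms {α : OneForm J N} (hα : α ∈ closedForms J N) {u : M → N}
    (hu : ContMDiff I J ∞ u) : α.pullback u hu ∈ closedForms I M := by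
  rw [mem_closed_iff]
  intro x v w
  have hx := mem_extChartAt_target (I := I) x
  have h : fderivWithin ℝ ((α.pullback u hu).inChart x) (range I) (extChartAt I x x) =
      fderivWithin ℝ (α.pullbackWithin (u ∘ (extChartAt I x).symm) (extChartAt I x).target)
        (extChartAt I x).target (extChartAt I x x) := by
    rw [fderivWithin_range_eq_target _ hx]
    exact fderivWithin_congr
      (fun y hy => pullbackAt_comp_mfderivWithin_extChartAt_symm α hu x hy)
      (pullbackAt_comp_mfderivWithin_extChartAt_symm α hu x hx)
  rw [h]
  exact fderivWithin_pullbackWithin_symm hα (uniqueDiffOn_extChartAt_target x)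
    extChartAt_target_subset_closure_interior (contMDiffOn_comp_extChartAt_symm hu x) hx v w

theorem inChart_coordinateForm (x₀ y : ℝ) :
    (((ContinuousLinearMap.id ℝ ℝ : ℝ →L[ℝ] ℝ).comp (mfderivWithin 𝓘(ℝ, ℝ) 𝓘(ℝ, ℝ)
      (extChartAt 𝓘(ℝ, ℝ) x₀).symm (range 𝓘(ℝ, ℝ)) y : ℝ →L[ℝ] ℝ)) : ℝ →L[ℝ] ℝ) =
      ContinuousLinearMap.id ℝ ℝ := by
  have h : mfderivWithin 𝓘(ℝ, ℝ) 𝓘(ℝ, ℝ) (id : ℝ → ℝ) (range 𝓘(ℝ, ℝ)) y =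
      ContinuousLinearMap.id ℝ ℝ :=
    mfderivWithin_id (𝓘(ℝ, ℝ).uniqueDiffOn _ (mem_range_self y)).uniqueMDiffWithinAt
  exact (congrArg (ContinuousLinearMap.id ℝ ℝ).comp h).trans (ContinuousLinearMap.id_comp _)

/-- The one-form `dx` on the real line. -/
noncomputable def DeRham.coordinateForm : OneForm 𝓘(ℝ, ℝ) ℝ where
  toFun _ := ContinuousLinearMap.id ℝ ℝ
  contMDiff_toFun x₀ := by
    refine contMDiffAt_cotangent_section ?_
    exact contDiffWithinAt_const.congr (fun y _ => inChart_coordinateForm x₀ y)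
      (inChart_coordinateForm x₀ _)

theorem coordinateForm_mem_closedForms : coordinateForm ∈ closedForms 𝓘(ℝ, ℝ) ℝ := by
  rw [mem_closed_iff]
  intro x v w
  have : coordinateForm.inChart x = fun _ => ContinuousLinearMap.id ℝ ℝ :=
    funext fun y => inChart_coordinateForm x y
  rw [this]
  simp

/-- The differential of a smooth function. -/
noncomputable def DeRham.OneForm.differential (f : M → ℝ) (hf : ContMDiff I 𝓘(ℝ, ℝ) ∞ f) :
    OneForm I M :=
  coordinateForm.pullback f hf

theorem differential_apply (f : M → ℝ) (hf : ContMDiff I 𝓘(ℝ, ℝ) ∞ f) (x : M) :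
    OneForm.differential f hf x = mvfderiv I f x := rfl

theorem differential_mem_closedForms (f : M → ℝ) (hf : ContMDiff I 𝓘(ℝ, ℝ) ∞ f) :
    OneForm.differential f hf ∈ closedForms I M :=
  pullback_mem_closedForms coordinateForm_mem_closedForms hf

end

section

variable {E : Type*} [NormedAddCommGroup E] [NormedSpace ℝ E]
  {H : Type*} [TopologicalSpace H] {I : ModelWithCorners ℝ E H}
  {M : Type*} [TopologicalSpace M] [ChartedSpace H M]

theorem exists_convex_chart (I : ModelWithCorners ℝ E H) (x₀ : M) :
    ∃ (U : Set M) (B : Set E), IsOpen U ∧ x₀ ∈ U ∧ U ⊆ (chartAt H x₀).source ∧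
      Convex ℝ B ∧ UniqueDiffOn ℝ B ∧ B ⊆ closure (interior B) ∧ B ⊆ (extChartAt I x₀).target ∧
      MapsTo (extChartAt I x₀) U B ∧ MapsTo (extChartAt I x₀).symm B U := by
  obtain ⟨ε, hε, hball⟩ := Metric.mem_nhdsWithin_iff.1 (extChartAt_target_mem_nhdsWithin (I := I) x₀)
  set y₀ := extChartAt I x₀ x₀
  have hconv : Convex ℝ (Metric.ball y₀ ε ∩ range I) := (convex_ball _ _).inter I.convex_range
  have hint : (interior (Metric.ball y₀ ε ∩ range I)).Nonempty := by
    rw [interior_inter, Metric.isOpen_ball.interior_eq]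
    exact mem_closure_iff.1 (I.range_subset_closure_interior (mem_range_self _)) _
      Metric.isOpen_ball (Metric.mem_ball_self hε)
  refine ⟨(extChartAt I x₀).source ∩ extChartAt I x₀ ⁻¹' Metric.ball y₀ ε, Metric.ball y₀ ε ∩ range I,
    (continuousOn_extChartAt x₀).isOpen_inter_preimage (isOpen_extChartAt_source x₀)
      Metric.isOpen_ball, ⟨mem_extChartAt_source x₀, Metric.mem_ball_self hε⟩, ?_, hconv,
    uniqueDiffOn_convex hconv hint, ?_, hball, fun x hx => ⟨hx.2, mem_range_self _⟩, fun y hy => ?_⟩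
  · rw [extChartAt_source]
    exact inter_subset_left
  · rw [hconv.closure_interior_eq_closure_of_nonempty_interior hint]
    exact subset_closure
  · refine ⟨(extChartAt I x₀).map_target (hball hy), ?_⟩
    rw [mem_preimage, (extChartAt I x₀).right_inv (hball hy)]
    exact hy.1

theorem exists_isOpen_connectedComponent_eq (I : ModelWithCorners ℝ E H) (x₀ : M) :
    ∃ U : Set M, IsOpen U ∧ x₀ ∈ U ∧ ∀ x ∈ U, connectedComponent x = connectedComponent x₀ := by
  obtain ⟨U, B, hU, hx₀, hUs, hB, -, -, hBt, hUB, hBU⟩ := exists_convex_chart I x₀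
  have himg : U = (extChartAt I x₀).symm '' B := by
    refine Subset.antisymm (fun x hx => ⟨_, hUB hx, ?_⟩) (image_subset_iff.2 hBU)
    exact (extChartAt I x₀).left_inv (by rw [extChartAt_source]; exact hUs hx)
  have hpre : IsPreconnected U := by
    rw [himg]
    exact hB.isPreconnected.image _ ((continuousOn_extChartAt_symm x₀).mono hBt)
  exact ⟨U, hU, hx₀, fun x hx =>
    (connectedComponent_eq (hpre.subset_connectedComponent hx₀ hx)).symm⟩

variable [IsManifold I ∞ M]
  {E' : Type*} [NormedAddCommGroup E'] [NormedSpace ℝ E']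
  {H' : Type*} [TopologicalSpace H'] {J : ModelWithCorners ℝ E' H'}
  {N : Type*} [TopologicalSpace N] [ChartedSpace H' N] [IsManifold J ∞ N]

theorem hasFDerivWithinAt_comp_extChartAt_symm {f : M → ℝ} {β : OneForm I M} {x₀ : M} {y : E}
    (hy : y ∈ (extChartAt I x₀).target)
    (hf : MDifferentiableAt I 𝓘(ℝ, ℝ) f ((extChartAt I x₀).symm y))
    (hβ : β ((extChartAt I x₀).symm y) = mvfderiv I f ((extChartAt I x₀).symm y)) :
    HasFDerivWithinAt (f ∘ (extChartAt I x₀).symm) (β.inChart x₀ y) (range I) y := by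
  have h := hf.hasMFDerivAt.comp_hasMFDerivWithinAt y
    (mdifferentiableWithinAt_extChartAt_symm (I := I) hy).hasMFDerivWithinAt
  have h2 := hasMFDerivWithinAt_iff_hasFDerivWithinAt.1 h
  unfold OneForm.inChart
  rw [hβ]
  exact h2

/-- Primitives of a smooth family of exact one-forms form a smooth family, if every connected
component contains a point at which all of them vanish. -/
theorem contMDiff_uncurry_primitive {f : N → M → ℝ} {β : N → OneForm I M}
    (hβ : ∀ (t₀ : N) (x₀ : M), ContDiffOn ℝ ∞
      (fun q : E' × E => (β ((extChartAt J t₀).symm q.1)).inChart x₀ q.2)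
      ((extChartAt J t₀).target ×ˢ (extChartAt I x₀).target))
    (hf : ∀ t, ContMDiff I 𝓘(ℝ, ℝ) ∞ (f t)) (hβf : ∀ t x, β t x = mvfderiv I (f t) x)
    (hb : ∀ x, ∃ b ∈ connectedComponent x, ∀ t, f t b = 0) :
    ContMDiff (J.prod I) 𝓘(ℝ, ℝ) ∞ (fun p : N × M => f p.1 p.2) := by
  have key : ∀ x₀ : M, ∃ U : Set M, IsOpen U ∧ x₀ ∈ U ∧ ∀ x₁ ∈ U, ∀ x ∈ U, ∀ t₀,
      ContMDiffAt (J.prod I) 𝓘(ℝ, ℝ) ∞ (fun p : N × M => f p.1 p.2 - f p.1 x₁) (t₀, x) := by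
    intro x₀
    obtain ⟨U, B, hU, hx₀, hUs, hB, hBu, -, hBt, hUB, hBU⟩ := exists_convex_chart I x₀
    refine ⟨U, hU, hx₀, fun x₁ hx₁ x hx t₀ => ?_⟩
    obtain ⟨V, A, hV, ht₀, hVs, hA, hAu, -, hAt, hVA, hAV⟩ := exists_convex_chart J t₀
    have hG := contDiffOn_primitive_sub
      (h := fun q : E' × E => f ((extChartAt J t₀).symm q.1) ((extChartAt I x₀).symm q.2))
      hA hB hAu hBu ((hβ t₀ x₀).mono (prod_mono hAt hBt))
      (fun p hp y hy => (hasFDerivWithinAt_comp_extChartAt_symm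
        (f := f ((extChartAt J t₀).symm p)) (hBt hy)
        ((hf _).mdifferentiableAt (by simp)) (hβf _ _)).mono
          (hBt.trans (extChartAt_target_subset_range x₀))) (hUB hx₁)
    have hm : ContMDiffOn (J.prod I) 𝓘(ℝ, E' × E) ∞
        (fun p : N × M => (extChartAt J t₀ p.1, extChartAt I x₀ p.2)) (V ×ˢ U) := by
      refine ContMDiffOn.prodMk_space ?_ ?_
      · exact ((contMDiffOn_extChartAt (I := J) (n := ∞)).mono hVs).comp contMDiffOn_fst
          fun p hp => hp.1
      · exact ((contMDiffOn_extChartAt (I := I) (n := ∞)).mono hUs).comp contMDiffOn_snd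
          fun p hp => hp.2
    have hGm := hG.contMDiffOn.comp hm fun p hp => ⟨hVA hp.1, hUB hp.2⟩
    refine (hGm.congr fun p hp => ?_).contMDiffAt ((hV.prod hU).mem_nhds ⟨ht₀, hx⟩)
    have h1 : (extChartAt J t₀).symm (extChartAt J t₀ p.1) = p.1 :=
      (extChartAt J t₀).left_inv (by rw [extChartAt_source]; exact hVs hp.1)
    have h2 : (extChartAt I x₀).symm (extChartAt I x₀ p.2) = p.2 :=
      (extChartAt I x₀).left_inv (by rw [extChartAt_source]; exact hUs hp.2)
    have h3 : (extChartAt I x₀).symm (extChartAt I x₀ x₁) = x₁ :=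
      (extChartAt I x₀).left_inv (by rw [extChartAt_source]; exact hUs hx₁)
    simp only [Function.comp_apply, h1, h2, h3]
  set S : Set M := {x | ContMDiff J 𝓘(ℝ, ℝ) ∞ (fun t => f t x)} with hS
  have hjoint : ∀ U : Set M, ∀ x₁ ∈ S, (∀ x ∈ U, ∀ t₀,
      ContMDiffAt (J.prod I) 𝓘(ℝ, ℝ) ∞ (fun p : N × M => f p.1 p.2 - f p.1 x₁) (t₀, x)) →
      ∀ x ∈ U, ∀ t₀, ContMDiffAt (J.prod I) 𝓘(ℝ, ℝ) ∞ (fun p : N × M => f p.1 p.2) (t₀, x) := by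
    intro U x₁ hx₁ h x hx t₀
    have h1 : ContMDiffAt (J.prod I) 𝓘(ℝ, ℝ) ∞ (fun p : N × M => f p.1 x₁) (t₀, x) :=
      (ContMDiff.comp hx₁ contMDiff_fst).contMDiffAt
    refine ((h x hx t₀).add h1).congr_of_eventuallyEq (.of_forall fun p => ?_)
    simp
  have hslice : ∀ x, (∀ t₀, ContMDiffAt (J.prod I) 𝓘(ℝ, ℝ) ∞ (fun p : N × M => f p.1 p.2)
      (t₀, x)) → x ∈ S := fun x h t₀ =>
    ContMDiffAt.comp t₀ (g := fun p : N × M => f p.1 p.2) (f := fun t => (t, x)) (h t₀)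
      (contMDiffAt_id.prodMk contMDiffAt_const)
  have hclopen : IsClopen S := by
    refine ⟨⟨isOpen_iff_mem_nhds.2 fun x hx => ?_⟩, isOpen_iff_mem_nhds.2 fun x hx => ?_⟩
    · obtain ⟨U, hU, hxU, h⟩ := key x
      refine Filter.mem_of_superset (hU.mem_nhds hxU) fun x₁ hx₁ hx₁S => hx ?_
      exact hslice x (hjoint U x₁ hx₁S (h x₁ hx₁) x hxU)
    · obtain ⟨U, hU, hxU, h⟩ := key x
      exact Filter.mem_of_superset (hU.mem_nhds hxU) fun x₁ hx₁ =>
        hslice x₁ (hjoint U x hx (h x hxU) x₁ hx₁)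
  rintro ⟨t, x⟩
  obtain ⟨b, hbx, hb0⟩ := hb x
  have hbS : b ∈ S := by
    simp only [hS, mem_ofPred_eq, hb0]
    exact contMDiff_const
  have hxS : x ∈ S := hclopen.connectedComponent_subset hbS
    ((connectedComponent_eq hbx) ▸ mem_connectedComponent)
  obtain ⟨U, hU, hxU, h⟩ := key x
  exact hjoint U x hxS (h x hxU) x hxU t

/-- A closed one-form on `N × M` restricting to a smooth family of closed one-forms whose
differences are exact. -/
theorem exists_closed_extension {ν : N → OneForm I M} (hν : IsSmoothFamily J ν)
    (hclosed : ∀ t, ν t ∈ closedForms I M) (t₀ : N) (hex : ∀ t, ν t - ν t₀ ∈ exactForms I M) :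
    ∃ μ : OneForm (J.prod I) (N × M), μ ∈ closedForms (J.prod I) (N × M) ∧
      ∀ (t : N) (x : M), μ.pullbackAt (I := I) (fun y : M => (t, y)) x = ν t x := by
  choose g hg hνg using hex
  set base : M → M := fun x => (Quotient.out (ConnectedComponents.mk x : ConnectedComponents M) : M)
  have hbase : ∀ x, connectedComponent (base x) = connectedComponent x := fun x =>
    ConnectedComponents.coe_eq_coe.1 (Quotient.out_eq _)
  set f : N → M → ℝ := fun t x => g t x - g t (base x) with hfdef
  have hev : ∀ t x₀, f t =ᶠ[𝓝 x₀] fun x => g t x - g t (base x₀) := by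
    intro t x₀
    obtain ⟨U, hU, hx₀, h⟩ := exists_isOpen_connectedComponent_eq I x₀
    filter_upwards [hU.mem_nhds hx₀] with x hx
    have : base x = base x₀ := congrArg Quotient.out (ConnectedComponents.coe_eq_coe.2 (h x hx))
    simp only [hfdef, this]
  have hf : ∀ t, ContMDiff I 𝓘(ℝ, ℝ) ∞ (f t) := fun t x₀ =>
    ((hg t).contMDiffAt.sub contMDiffAt_const).congr_of_eventuallyEq (hev t x₀)
  have hβf : ∀ t x, (ν t - ν t₀) x = mvfderiv I (f t) x := by
    intro t x
    have h1 : mvfderiv I (f t) x = mvfderiv I (fun y => g t y - g t (base x)) x := by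
      unfold mvfderiv
      rw [(hev t x).mfderiv_eq, (hev t x).eq_of_nhds]
    rw [h1, hνg]
    have h2 := mvfderiv_sub (I := I) (x := x) ((hg t).mdifferentiableAt (by simp))
      (mdifferentiableAt_const (c := g t (base x)))
    rw [mvfderiv_const, sub_zero] at h2
    exact h2.symm
  have hF := contMDiff_uncurry_primitive (J := J) (f := f) (β := fun t => ν t - ν t₀) ?_ hf hβf
    fun x => ⟨base x, (hbase x) ▸ mem_connectedComponent, fun t => ?_⟩
  · refine ⟨(ν t₀).pullback Prod.snd contMDiff_snd + OneForm.differential _ hF,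
      add_mem (pullback_mem_closedForms (hclosed t₀) _) (differential_mem_closedForms _ hF), ?_⟩
    intro t x
    have hi : MDifferentiableAt I (J.prod I) (fun y : M => (t, y)) x :=
      mdifferentiableAt_const.prodMk mdifferentiableAt_id
    have e1 : (mfderiv (J.prod I) I Prod.snd (t, x)).comp
        (mfderiv I (J.prod I) (fun y : M => (t, y)) x) = ContinuousLinearMap.id ℝ _ := by
      rw [← mfderiv_comp x mdifferentiableAt_snd hi]
      exact mfderiv_id
    have e2 : (mvfderiv (J.prod I) (fun p : N × M => f p.1 p.2) (t, x)).comp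
        (mfderiv I (J.prod I) (fun y : M => (t, y)) x) = mvfderiv I (f t) x :=
      (mvfderiv_comp x (hF.mdifferentiableAt (by simp)) hi).symm
    rw [← hβf] at e2
    have e3 : (ν t₀).pullbackAt (I := J.prod I) Prod.snd (t, x) =
      (ν t₀ x).comp (mfderiv (J.prod I) I Prod.snd (t, x)) := rfl
    ext v
    have e1v := congrArg (fun L => ν t₀ x (L v)) e1
    have e2v := congrArg (fun L => L v) e2
    exact (congrArg₂ (· + ·) e1v e2v).trans (by simp)
  · intro t₁ x₁
    exact (IsSmoothFamily.contDiffOn_inChart hν t₁ x₁).sub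
      ((contDiffOn_inChart (ν t₀) x₁).comp contDiffOn_snd fun q hq => hq.2)
  · have : base (base x) = base x :=
      congrArg Quotient.out (ConnectedComponents.coe_eq_coe.2 (hbase x))
    simp [hfdef, this]

end

section

variable {E : Type*} [NormedAddCommGroup E] [NormedSpace ℝ E]
  {H : Type*} [TopologicalSpace H] {I : ModelWithCorners ℝ E H}
  {M : Type*} [TopologicalSpace M] [ChartedSpace H M] [IsManifold I ∞ M]
  {E' : Type*} [NormedAddCommGroup E'] [NormedSpace ℝ E']
  {H' : Type*} [TopologicalSpace H'] {J : ModelWithCorners ℝ E' H'}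
  {N : Type*} [TopologicalSpace N] [ChartedSpace H' N] [IsManifold J ∞ N]

theorem pullbackWithin_comp {Q Q' : Type*} [NormedAddCommGroup Q] [NormedSpace ℝ Q]
    [NormedAddCommGroup Q'] [NormedSpace ℝ Q'] (α : OneForm I M) {h : Q → M} {s : Set Q}
    {j : Q' → Q} {j' : Q' →L[ℝ] Q} {t : Set Q'} {q : Q'} (hj : HasFDerivWithinAt j j' t q)
    (ht : UniqueDiffWithinAt ℝ t q) (hts : MapsTo j t s)
    (hh : MDifferentiableWithinAt 𝓘(ℝ, Q) I h s (j q)) :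
    (α.pullbackWithin h s (j q)).comp j' = α.pullbackWithin (h ∘ j) t q := by
  have h1 := (hh.hasMFDerivWithinAt.comp q hj.hasMFDerivWithinAt hts).mfderivWithin
    ht.uniqueMDiffWithinAt
  unfold OneForm.pullbackWithin
  rw [h1]
  rfl

/-- The restrictions of a closed one-form on `N × M` to two slices, over the endpoints of a path,
differ by an exact form. -/
theorem sub_mem_exactForms_of_closed_extension {μ : OneForm (J.prod I) (N × M)}
    (hμ : μ ∈ closedForms (J.prod I) (N × M)) {γ : ℝ → N} (hγ : ContMDiff 𝓘(ℝ, ℝ) J ∞ γ)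
    {ν : N → OneForm I M}
    (hν : ∀ (t : N) (x : M), μ.pullbackAt (I := I) (fun y : M => (t, y)) x = ν t x) :
    ν (γ 1) - ν (γ 0) ∈ exactForms I M := by
  set β := ν (γ 1) - ν (γ 0) with hβ
  set f : M → ℝ := fun x => ∫ r in (0 : ℝ)..1,
    μ.pullbackWithin (fun r : ℝ => (γ r, x)) (Icc 0 1) r 1 with hf
  have key : ∀ x₀ : M, ∃ (U : Set M) (B : Set E), IsOpen U ∧ x₀ ∈ U ∧
      U ⊆ (chartAt H x₀).source ∧ UniqueDiffOn ℝ B ∧ B ⊆ (extChartAt I x₀).target ∧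
      MapsTo (extChartAt I x₀) U B ∧
      ∀ y ∈ B, HasFDerivWithinAt (f ∘ (extChartAt I x₀).symm) (β.inChart x₀ y) B y := by
    intro x₀
    obtain ⟨U, B, hU, hx₀, hUs, hB, hBu, hBi, hBt, hUB, hBU⟩ := exists_convex_chart I x₀
    refine ⟨U, B, hU, hx₀, hUs, hBu, hBt, hUB, ?_⟩
    set s : Set (E × ℝ) := B ×ˢ Icc (0 : ℝ) 1 with hs
    set h : E × ℝ → N × M := fun q => (γ q.2, (extChartAt I x₀).symm q.1) with hh
    have hsu : UniqueDiffOn ℝ s := hBu.prod uniqueDiffOn_Icc_zero_one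
    have hsi : s ⊆ closure (interior s) := by
      rw [hs, interior_prod_eq, closure_prod_eq]
      refine prod_mono hBi ?_
      rw [interior_Icc, closure_Ioo zero_ne_one]
    have hhs : ContMDiffOn 𝓘(ℝ, E × ℝ) (J.prod I) ∞ h s := by
      refine ContMDiffOn.prodMk ?_ ?_
      · exact (hγ.comp contDiff_snd.contMDiff).contMDiffOn
      · exact (contMDiffOn_extChartAt_symm x₀).comp contDiff_fst.contMDiff.contMDiffOn
          fun q hq => hBt hq.1
    have hhd : ∀ q ∈ s, MDifferentiableWithinAt 𝓘(ℝ, E × ℝ) (J.prod I) h s q :=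
      fun q hq => (hhs q hq).mdifferentiableWithinAt (by simp)
    set θ := μ.pullbackWithin h s with hθ
    have hθs : ContDiffOn ℝ ∞ θ s := contDiffOn_pullbackWithin μ hsu hhs
    obtain ⟨G, hG⟩ := (hB.prod (convex_Icc (0 : ℝ) 1)).exists_forall_hasFDerivWithinAt_of_fderivWithin_symmetric
      (hθs.differentiableOn (by simp))
      (fun a ha v _ w _ => fderivWithin_pullbackWithin_symm hμ hsu hsi hhs ha v w)
    have hx : ∀ r ∈ Icc (0 : ℝ) 1, ∀ y ∈ B,
        (θ (y, r)).comp (ContinuousLinearMap.inl ℝ E ℝ) = (ν (γ r)).inChart x₀ y := by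
      intro r hr y hy
      rw [hθ, pullbackWithin_comp μ (j := fun y => (y, r))
        (hasFDerivAt_prodMk_left y r).hasFDerivWithinAt (hBu y hy) (fun z hz => (⟨hz, hr⟩ : (z, r) ∈ s))
        (hhd _ ⟨hy, hr⟩)]
      have hd := mdifferentiableWithinAt_extChartAt_symm (I := I) (hBt hy)
      have hi : MDifferentiableAt I (J.prod I) (fun z : M => (γ r, z))
          ((extChartAt I x₀).symm y) := mdifferentiableAt_const.prodMk mdifferentiableAt_id
      have h1 := (hi.hasMFDerivAt.comp_hasMFDerivWithinAt y
        (hd.hasMFDerivWithinAt.mono (hBt.trans (extChartAt_target_subset_range x₀)))).mfderivWithin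
        (hBu y hy).uniqueMDiffWithinAt
      unfold OneForm.inChart OneForm.pullbackWithin
      rw [← hν]
      exact congrArg (fun L => (μ (γ r, (extChartAt I x₀).symm y)).comp L) h1
    have hr : ∀ y ∈ B, ∀ r ∈ Icc (0 : ℝ) 1, θ (y, r) (0, 1) =
        μ.pullbackWithin (fun r : ℝ => (γ r, (extChartAt I x₀).symm y)) (Icc 0 1) r 1 := by
      intro y hy r hr
      have := pullbackWithin_comp μ (j := fun r => (y, r)) (s := s) (h := h) (t := Icc (0 : ℝ) 1)
        (hasFDerivAt_prodMk_right y r).hasFDerivWithinAt (uniqueDiffOn_Icc_zero_one r hr)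
        (fun z hz => ⟨hy, hz⟩) (hhd _ ⟨hy, hr⟩)
      exact congrArg (fun L => L 1) this
    have hfG : ∀ y ∈ B, (f ∘ (extChartAt I x₀).symm) y = G (y, 1) - G (y, 0) := by
      intro y hy
      have hd : ∀ r ∈ Icc (0 : ℝ) 1, HasDerivWithinAt (fun r => G (y, r)) (θ (y, r) (0, 1))
          (Icc 0 1) r := by
        intro r hr
        have h1 : HasDerivWithinAt (fun r : ℝ => (y, r)) ((0 : E), (1 : ℝ)) (Icc 0 1) r :=
          (hasDerivWithinAt_const r _ y).prodMk (hasDerivWithinAt_id r _)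
        exact (hG (y, r) ⟨hy, hr⟩).comp_hasDerivWithinAt r h1 fun z hz => ⟨hy, hz⟩
      have hc : ContinuousOn (fun r : ℝ => θ (y, r) (0, 1)) (Icc 0 1) :=
        (hθs.continuousOn.comp (by fun_prop) fun r hr => (⟨hy, hr⟩ : (y, r) ∈ s)).clm_apply
          continuousOn_const
      rw [← intervalIntegral.integral_eq_sub_of_hasDeriv_right_of_le zero_le_one
        (fun r hr => (hd r hr).continuousWithinAt)
        (fun r hr => ((hd r (Ioo_subset_Icc_self hr)).hasDerivAt
          (Icc_mem_nhds hr.1 hr.2)).hasDerivWithinAt)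
        (hc.intervalIntegrable_of_Icc zero_le_one)]
      refine intervalIntegral.integral_congr fun r hr' => ?_
      rw [uIcc_of_le zero_le_one] at hr'
      exact (hr y hy r hr').symm
    intro y hy
    have hGr : ∀ r ∈ Icc (0 : ℝ) 1,
        HasFDerivWithinAt (fun y => G (y, r)) ((ν (γ r)).inChart x₀ y) B y := by
      intro r hr
      rw [← hx r hr y hy]
      exact (hG (y, r) ⟨hy, hr⟩).comp y (hasFDerivAt_prodMk_left y r).hasFDerivWithinAt
        fun z hz => (⟨hz, hr⟩ : (z, r) ∈ s)
    exact ((hGr 1 (by simp)).sub (hGr 0 (by simp))).congr hfG (hfG y hy)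
  have hfs : ContMDiff I 𝓘(ℝ, ℝ) ∞ f := by
    intro x₀
    obtain ⟨U, B, hU, hx₀, hUs, hBu, hBt, hUB, hd⟩ := key x₀
    have h1 : ContDiffOn ℝ ∞ (f ∘ (extChartAt I x₀).symm) B := by
      have : ContDiffOn ℝ (∞ + 1) (f ∘ (extChartAt I x₀).symm) B := by
        rw [contDiffOn_succ_iff_hasFDerivWithinAt_of_uniqueDiffOn hBu]
        exact ⟨by simp, _, (contDiffOn_inChart β x₀).mono hBt, hd⟩
      simpa using this
    have h2 := h1.contMDiffOn.comp
      ((contMDiffOn_extChartAt (I := I) (n := ∞)).mono hUs) hUB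
    refine (h2.congr fun x hx => ?_).contMDiffAt (hU.mem_nhds hx₀)
    simp only [Function.comp_apply]
    rw [(extChartAt I x₀).left_inv (by rw [extChartAt_source]; exact hUs hx)]
  refine ⟨f, hfs, fun x₀ => ?_⟩
  obtain ⟨U, B, hU, hx₀, hUs, hBu, hBt, hUB, hd⟩ := key x₀
  have h1 := hd _ (hUB hx₀)
  have h2 := (hasFDerivWithinAt_comp_extChartAt_symm (f := f) (β := OneForm.differential f hfs)
    (mem_extChartAt_target x₀) (hfs.mdifferentiableAt (by simp)) (differential_apply f hfs _)).mono
    (hBt.trans (extChartAt_target_subset_range x₀))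
  have h3 := (hBu _ (hUB hx₀)).eq h1 h2
  rw [inChart_self, inChart_self] at h3
  exact h3

end

theorem cohomologyClass_eq_iff {E : Type*} [NormedAddCommGroup E] [NormedSpace ℝ E]
    {H : Type*} [TopologicalSpace H] {I : ModelWithCorners ℝ E H}
    {M : Type*} [TopologicalSpace M] [ChartedSpace H M] [IsManifold I ∞ M]
    (α β : closedForms I M) :
    cohomologyClass α = cohomologyClass β ↔ (α : OneForm I M) - β ∈ exactForms I M :=
  Submodule.Quotient.eq _

end

theorem mainTheorem8 {E : Type*} [NormedAddCommGroup E] [NormedSpace ℝ E] [FiniteDimensional ℝ E]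
    {H : Type*} [TopologicalSpace H] (I : ModelWithCorners ℝ E H)
    (S : Type*) [TopologicalSpace S] [ChartedSpace H S] [IsManifold I ∞ S]
    [T2Space S] [SecondCountableTopology S]
    (ν : Circle → OneForm I S) (hν : IsSmoothFamily (𝓡 1) ν)
    (hclosed : ∀ t, ν t ∈ closedForms I S) :
    (∃ μ : OneForm ((𝓡 1).prod I) (Circle × S),
        μ ∈ closedForms ((𝓡 1).prod I) (Circle × S) ∧
        ∀ (t : Circle) (x : S), μ.pullbackAt (I := I) (fun y : S => (t, y)) x = ν t x) ↔
      ∀ s t : Circle,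
        cohomologyClass (⟨ν s, hclosed s⟩ : closedForms I S) =
          cohomologyClass (⟨ν t, hclosed t⟩ : closedForms I S) := by
  simp only [cohomologyClass_eq_iff]
  constructor
  · rintro ⟨μ, hμ, hμν⟩ s t
    have hγ : ContMDiff 𝓘(ℝ, ℝ) (𝓡 1) ∞
        (fun r : ℝ => Circle.exp (Complex.arg t + r * (Complex.arg s - Complex.arg t))) :=
      contMDiff_circleExp.comp (ContDiff.contMDiff (by fun_prop))
    simpa using sub_mem_exactForms_of_closed_extension hμ hγ hμν
  · intro h
    exact exists_closed_extension hν hclosed 1 fun t => h t 1
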